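/- Let $H$ be a Hilbert $C^*$-module over a $C^*$-algebra $\mathfrak{A}$, and let $\mathcal{L}(H)$ be the $C^*$-algebra of adjointable operators on $H$, with identity $I$ and the operator norm. A projection is a self-adjoint idempotent in $\mathcal{L}(H)$; $\mathcal{R}(\cdot)$ and $\mathcal{N}(\cdot)$ denote range and null space. For an idempotent $Q\in\mathcal{L}(H)$ (that is, $Q^2=Q$) the matched projection $m(Q)\in\mathcal{L}(H)$ is defined as follows. If $Q$ is a projection, then $m(Q)=Q$. Otherwise, let $P_{\mathcal{R}(Q)}$ be the projection of $H$ onto $\mathcal{R}(Q)$, let $I_1$ be the identity on $\mathcal{R}(Q)$, put $A=(Q-P_{\mathcal{R}(Q)})|_{\mathcal{N}(Q^*)}\colon \mathcal{N}(Q^*)\to\mathcal{R}(Q)$ and $B=(AA^*+I_1)^{1/2}$; then $m(Q)$ is the operator which, with respect to the orthogonal decomposition $H=\mathcal{R}(Q)\oplus\mathcal{N}(Q^*)$, has the block matrix $$\frac12\begin{pmatrix}(B+I_1)B^{-1} & B^{-1}A\\ A^*B^{-1} & A^*\big[B(B+I_1)\big]^{-1}A\end{pmatrix}.$$ Theorem.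 For every nonzero idempotent $Q\in\mathcal{L}(H)$, $$\|m(Q)-Q\|=\frac12\Big(\|Q\|-1+\sqrt{\|Q\|^2-1}\Big).$$ -/

import Mathlib

/-! Adjointable operators on Hilbert `C⋆`-modules, and the matched projection of an idempotent. -/

noncomputable section HilbertModules

set_option linter.unusedSectionVars false

open scoped InnerProductSpace

section Adjointable

variable (A E : Type*) [NonUnitalCStarAlgebra A] [PartialOrder A] [StarOrderedRing A]
  [NormedAddCommGroup E] [NormedSpace ℂ E] [SMul A E] [CStarModule A E]

/-- The algebra `𝓛(E)` of all adjointable operators on a Hilbert `C⋆`-module `E` over `A`, as a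
unital subalgebra of the bounded operators on `E`; in particular it carries the operator norm.
(On a complete `E`, boundedness, linearity and `A`-linearity of a map that has an adjoint are
automatic.) -/
def adjointableSubalgebra : Subalgebra ℂ (E →L[ℂ] E) where
  carrier := {T | ∃ S : E →L[ℂ] E, ∀ x y : E, inner A (T x) y = inner A x (S y)}
  mul_mem' := by
    rintro T₁ T₂ ⟨S₁, h₁⟩ ⟨S₂, h₂⟩
    exact ⟨S₂ * S₁, fun x y => by simp [h₁, h₂]⟩
  add_mem' := by
    rintro T₁ T₂ ⟨S₁, h₁⟩ ⟨S₂, h₂⟩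
    exact ⟨S₁ + S₂, fun x y => by simp [h₁, h₂]⟩
  algebraMap_mem' := fun r =>
    ⟨algebraMap ℂ (E →L[ℂ] E) (star r), fun x y => by simp [Algebra.algebraMap_eq_smul_one]⟩

/-- The algebra `𝓛(E)` of adjointable operators, as a type. -/
def Adjointable : Type _ := adjointableSubalgebra A E

instance Adjointable.instNormedRing : NormedRing (Adjointable A E) :=
  inferInstanceAs (NormedRing (adjointableSubalgebra A E))

instance Adjointable.instNormedAlgebra : NormedAlgebra ℂ (Adjointable A E) :=
  inferInstanceAs (NormedAlgebra ℂ (adjointableSubalgebra A E))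

variable {A E}

/-- The bounded operator on `E` underlying an element of `𝓛(E)`. -/
def Adjointable.toCLM (T : Adjointable A E) : E →L[ℂ] E := T.1

@[simp] theorem Adjointable.toCLM_mul (S T : Adjointable A E) (x : E) :
    (S * T).toCLM x = S.toCLM (T.toCLM x) := rfl

@[simp] theorem Adjointable.toCLM_add (S T : Adjointable A E) (x : E) :
    (S + T).toCLM x = S.toCLM x + T.toCLM x := rfl

@[simp] theorem Adjointable.toCLM_smul (c : ℂ) (T : Adjointable A E) (x : E) :
    (c • T).toCLM x = c • T.toCLM x := rfl

theorem Adjointable.norm_def (T : Adjointable A E) : ‖T‖ = ‖T.toCLM‖ := rfl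

theorem Adjointable.toCLM_injective :
    Function.Injective (Adjointable.toCLM : Adjointable A E → E →L[ℂ] E) :=
  Subtype.val_injective

theorem Adjointable.eq_of_forall_inner_right {x y : E}
    (h : ∀ z : E, inner A z x = inner A z y) : x = y := by
  rw [← sub_eq_zero, ← CStarModule.inner_self (A := A)]
  simp [CStarModule.inner_sub_right, h]

namespace Adjointable

/-- The adjoint `T*` of an adjointable operator `T`. -/
instance instStar : Star (Adjointable A E) where
  star T := ⟨T.2.choose, T.toCLM, fun x y => by
    have h := congrArg star (T.2.choose_spec y x)
    rw [CStarModule.star_inner, CStarModule.star_inner] at h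
    exact h.symm⟩

/-- The defining property of the adjoint: `⟪T x, y⟫ = ⟪x, T* y⟫`. -/
theorem inner_left (T : Adjointable A E) (x y : E) :
    inner A (T.toCLM x) y = inner A x ((star T).toCLM y) :=
  T.2.choose_spec x y

theorem inner_right (T : Adjointable A E) (x y : E) :
    inner A x (T.toCLM y) = inner A ((star T).toCLM x) y := by
  rw [← CStarModule.star_inner _ x, inner_left, CStarModule.star_inner]

theorem star_eq_of_inner {T S : Adjointable A E}
    (h : ∀ x y : E, inner A (T.toCLM x) y = inner A x (S.toCLM y)) :
    star T = S := by
  refine toCLM_injective (ContinuousLinearMap.ext fun y => ?_)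
  refine eq_of_forall_inner_right (A := A) fun x => ?_
  rw [← inner_left, h]

instance instStarRing : StarRing (Adjointable A E) where
  star_involutive T := star_eq_of_inner fun x y => (inner_right T x y).symm
  star_mul S T := star_eq_of_inner fun x y => by
    simp [inner_left]
  star_add S T := star_eq_of_inner fun x y => by
    simp [inner_left]

instance instStarModule : StarModule ℂ (Adjointable A E) where
  star_smul c T := star_eq_of_inner fun x y => by
    simp [inner_left]

theorem norm_sq_le (T : Adjointable A E) : ‖T‖ ^ 2 ≤ ‖star T * T‖ := by
  have key : ‖T.toCLM‖ ≤ √‖star T * T‖ := by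
    refine ContinuousLinearMap.opNorm_le_bound _ (Real.sqrt_nonneg _) fun x => ?_
    have h1 : ‖T.toCLM x‖ ^ 2 ≤ ‖star T * T‖ * ‖x‖ ^ 2 := by
      rw [CStarModule.norm_sq_eq A, inner_left]
      refine (CStarModule.norm_inner_le E).trans ?_
      have h2 : ‖(star T).toCLM (T.toCLM x)‖ ≤ ‖star T * T‖ * ‖x‖ :=
        ContinuousLinearMap.le_opNorm (star T * T).toCLM x
      calc ‖x‖ * ‖(star T).toCLM (T.toCLM x)‖
          ≤ ‖x‖ * (‖star T * T‖ * ‖x‖) := by gcongr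
        _ = ‖star T * T‖ * ‖x‖ ^ 2 := by ring
    refine (sq_le_sq₀ (norm_nonneg _) (by positivity)).1 ?_
    rwa [mul_pow, Real.sq_sqrt (norm_nonneg _)]
  calc ‖T‖ ^ 2 ≤ (√‖star T * T‖) ^ 2 := by
        gcongr
        exact key
    _ = ‖star T * T‖ := Real.sq_sqrt (norm_nonneg _)

instance instCStarRing : CStarRing (Adjointable A E) where
  norm_mul_self_le T := by
    rw [← sq]
    exact norm_sq_le T

instance instCompleteSpace [CompleteSpace E] : CompleteSpace (Adjointable A E) := by
  refine Metric.complete_of_cauchySeq_tendsto fun u hu => ?_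
  have hv : CauchySeq fun n => star (u n) := by
    rw [Metric.cauchySeq_iff] at hu ⊢
    intro ε hε
    obtain ⟨N, hN⟩ := hu ε hε
    refine ⟨N, fun m hm n hn => ?_⟩
    have h := hN m hm n hn
    rwa [dist_eq_norm, ← star_sub, norm_star, ← dist_eq_norm]
  have hu' : CauchySeq fun n => (u n).toCLM :=
    hu.map uniformContinuous_subtype_val
  have hv' : CauchySeq fun n => (star (u n)).toCLM :=
    hv.map uniformContinuous_subtype_val
  obtain ⟨T, hT⟩ := cauchySeq_tendsto_of_complete hu'
  obtain ⟨S, hS⟩ := cauchySeq_tendsto_of_complete hv'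
  have hTS : ∀ x y : E, inner A (T x) y = inner A x (S y) := fun x y => by
    have hT1 : Filter.Tendsto (fun n => (u n).toCLM x) Filter.atTop (nhds (T x)) :=
      ((ContinuousLinearMap.apply ℂ E x).continuous.tendsto T).comp hT
    have hS1 : Filter.Tendsto (fun n => (star (u n)).toCLM y)
        Filter.atTop (nhds (S y)) :=
      ((ContinuousLinearMap.apply ℂ E y).continuous.tendsto S).comp hS
    have c := CStarModule.continuous_inner (A := A) (E := E)
    have l1 := (c.tendsto (T x, y)).comp (hT1.prodMk_nhds tendsto_const_nhds)
    have l2 := (c.tendsto (x, S y)).comp ((tendsto_const_nhds (x := x)).prodMk_nhds hS1)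
    refine tendsto_nhds_unique l1 (l2.congr fun n => ?_)
    exact (inner_left (u n) x y).symm
  exact ⟨⟨T, S, hTS⟩, tendsto_subtype_rng.2 hT⟩

/-- The adjointable operators on a Hilbert `C⋆`-module form a unital `C⋆`-algebra. -/
instance instCStarAlgebra [CompleteSpace E] : CStarAlgebra (Adjointable A E) where

end Adjointable

end Adjointable

section MatchedProjection

variable {A E : Type*} [NonUnitalCStarAlgebra A] [PartialOrder A] [StarOrderedRing A]
  [NormedAddCommGroup E] [NormedSpace ℂ E] [SMul A E] [CStarModule A E] [CompleteSpace E]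

/-- The range of an adjointable idempotent is the range of a projection (a self-adjoint
idempotent) in `𝓛(E)`. -/
theorem Adjointable.exists_rangeProjection {Q : Adjointable A E} (hQ : IsIdempotentElem Q) :
    ∃ P : Adjointable A E, IsStarProjection P ∧
      Set.range P.toCLM = Set.range Q.toCLM := by
  have hq : Q * Q = Q := hQ
  have hq' : star Q * star Q = star Q := by rw [← star_mul, hq]
  set T := Q + star Q - 1 with hT
  have hTQ : T * Q = star Q * Q := by rw [hT, sub_mul, add_mul, hq]; simp
  have hQT : star Q * T = star Q * Q := by rw [hT, mul_sub, mul_add, hq']; simp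
  have hTT : T * T = 1 + star (star Q - Q) * (star Q - Q) := by
    simp only [hT, star_sub, star_star, mul_sub, sub_mul, mul_add, add_mul, hq, hq', mul_one,
      one_mul]
    abel
  have hu : IsUnit (T * T) := by
    have h1 : (-1 : ℝ) ∉ spectrum ℝ (star (star Q - Q) * (star Q - Q)) := fun h => by
      have := spectrum_star_mul_self_nonneg _ h
      linarith
    rw [spectrum.notMem_iff] at h1
    have h2 : T * T = -(algebraMap ℝ (Adjointable A E) (-1)
        - star (star Q - Q) * (star Q - Q)) := by
      rw [hTT, map_neg, map_one]; abel
    rw [h2]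
    exact h1.neg
  obtain ⟨t, ht⟩ : IsUnit T := ((Commute.refl T).isUnit_mul_iff.1 hu).1
  have a1 : Q * (↑t⁻¹ : Adjointable A E) = ↑t⁻¹ * star Q := by
    rw [Units.mul_inv_eq_iff_eq_mul, mul_assoc, Units.eq_inv_mul_iff_mul_eq, ht, hTQ, hQT]
  have hPQ : Q * (↑t⁻¹ : Adjointable A E) * Q = Q := by
    rw [a1, mul_assoc, Units.inv_mul_eq_iff_eq_mul, ht, hTQ]
  have hsT : star (↑t : Adjointable A E) = t := by
    rw [ht, hT]; simp [add_comm]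
  have hst : star (↑t⁻¹ : Adjointable A E) = ↑t⁻¹ := by
    rw [← Units.coe_star_inv, show star t = t from Units.ext hsT]
  refine ⟨Q * (↑t⁻¹ : Adjointable A E), ⟨?_, ?_⟩, ?_⟩
  · change Q * (↑t⁻¹ : Adjointable A E) * (Q * ↑t⁻¹) = Q * ↑t⁻¹
    rw [← mul_assoc, hPQ]
  · change star (Q * (↑t⁻¹ : Adjointable A E)) = Q * ↑t⁻¹
    rw [star_mul, hst, a1]
  · apply le_antisymm
    · rintro _ ⟨x, rfl⟩
      exact ⟨(↑t⁻¹ : Adjointable A E).toCLM x, rfl⟩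
    · rintro _ ⟨x, rfl⟩
      refine ⟨Q.toCLM x, ?_⟩
      exact DFunLike.congr_fun (congrArg Adjointable.toCLM hPQ) x

/-- The projection `P_{𝓡(Q)}` of `E` onto the range of an idempotent `Q`. -/
def rangeProjection (Q : Adjointable A E) (hQ : IsIdempotentElem Q) : Adjointable A E :=
  (Adjointable.exists_rangeProjection hQ).choose

/-- The operator `A = (Q - P_{𝓡(Q)})|_{𝓝(Q*)}` from `𝓝(Q*) = 𝓡(Q)ᗮ` to `𝓡(Q)`, the upper right
block of `Q = [I A; 0 0]` on `E = 𝓡(Q) ⊕ 𝓝(Q*)`, extended by zero to all of `E`. -/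
def offDiagonalBlock (Q : Adjointable A E) (hQ : IsIdempotentElem Q) : Adjointable A E :=
  (Q - rangeProjection Q hQ) * (1 - rangeProjection Q hQ)

/-- The operator `B = (A A* + I)^{1/2}` on `𝓡(Q)`, where `A = offDiagonalBlock Q hQ`, extended by
the identity on `𝓝(Q*)` (where `A A*` vanishes). The square root is taken in the `C⋆`-algebra
`𝓛(E)`. -/
def sqrtBlock (Q : Adjointable A E) (hQ : IsIdempotentElem Q) : Adjointable A E :=
  cfc Real.sqrt (offDiagonalBlock Q hQ * star (offDiagonalBlock Q hQ) + 1)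

open Classical in
/-- The matched projection `m(Q)` of an idempotent `Q`. It is `Q` if `Q` is a projection;
otherwise it is the operator whose block matrix on `E = 𝓡(Q) ⊕ 𝓝(Q*)` is
`1/2 [(B + I) B⁻¹, B⁻¹ A; A* B⁻¹, A* (B (B + I))⁻¹ A]`,
with `A` and `B` as in `offDiagonalBlock` and `sqrtBlock`. (Both `B` and `B (B + I)` are
invertible, so `Ring.inverse` is the actual inverse.) -/
def matchedProjection (Q : Adjointable A E) (hQ : IsIdempotentElem Q) : Adjointable A E :=
  if IsStarProjection Q then Q else
    let P := rangeProjection Q hQ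
    let a := offDiagonalBlock Q hQ
    let b := sqrtBlock Q hQ
    (1 / 2 : ℂ) •
      (P * ((b + 1) * Ring.inverse b) * P
        + P * (Ring.inverse b * a) * (1 - P)
        + (1 - P) * (star a * Ring.inverse b) * P
        + (1 - P) * (star a * Ring.inverse (b * (b + 1)) * a) * (1 - P))

end MatchedProjection

end HilbertModules

/-! ### Order and norm bounds for the off-diagonal part -/

section OffDiagonal

variable {M : Type*} [CStarAlgebra M]

/-! Let `p` be the projection onto the range of `Q` and `a = Q - p`, so that `p a = a` and `a p =
0`. Put `T = a + a⋆`, `F = a - a⋆` and `G = 2p - 1 + T = Q + Q⋆ - 1`. The symmetry `2p - 1`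
anticommutes with `T`, so `G² = 1 + T² = s²` with `s = (1 + T²)^{1/2}`. The block matrix of `m(Q)`
says exactly that `2 m(Q) - 1 = G s⁻¹`, the sign of `G`; hence `2 (m(Q) - Q) = e` with `e = G (s⁻¹ -
1) - F` (`matched_block_formula`). The rest is the computation of `‖e‖` in an abstract C⋆-algebra.

Upper bound (`norm_sub_le_of_offDiagonal`): the triangle inequality, since `|G (s⁻¹ - 1)| = |s -
1|`, `|F|² = T²` and `T² ≤ ‖Q‖² - 1`.

Lower bound (`le_norm_sub_of_offDiagonal`): `e e⋆ = 2s² - 2s + 2(1 - s⁻¹)K` with `K = (2p - 1)T² -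
T` (`sub_mul_star_sub`). For the scalar model `Q = [1 t; 0 0]`, `K = [t² -t; -t -t²]` has eigenvalue
`t√(1 + t²)` with eigenvector `(t(t + √(1 + t²)), -t)`. Replacing `t` by `β = (a a⋆)^{1/2}` in the
first entry and by `a⋆` in the second gives `w` such that `e e⋆ w = w g(z)` and `w⋆ w = f(z)`, where
`z = 1 + a a⋆` (`mul_eigenvector`, `star_eigenvector_mul`). Comparing `w⋆ e e⋆ w ≤ ‖e‖² w⋆ w` at the
spectral value `‖Q‖²` of `z` gives `g(‖Q‖²) ≤ ‖e‖²`, and `g(‖Q‖²)` is the square of the upper bound.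
-/

theorem one_le_norm_of_isIdempotentElem {q : M} (hq : IsIdempotentElem q) (h0 : q ≠ 0) :
    1 ≤ ‖q‖ := by
  have h1 : 0 < ‖q‖ := norm_pos_iff.2 h0
  have h2 : ‖q‖ ≤ ‖q‖ * ‖q‖ := by
    conv_lhs => rw [← hq.eq]
    exact norm_mul_le q q
  nlinarith

theorem ringInverse_eq_of_mul_eq_one {b c : M} (h : b * c = 1) (h' : c * b = 1) :
    Ring.inverse b = c :=
  Ring.inverse_unit ⟨b, c, h, h'⟩

theorem mul_mul_of_mul_eq {x y z : M} (h : x * y = z) (c : M) : x * (y * c) = z * c := by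
  rw [← mul_assoc, h]

variable {p a : M}

theorem offDiagonal_mul_self (hpa : p * a = a) (hap : a * p = 0) : a * a = 0 := by
  rw [← hpa, ← mul_assoc, mul_assoc p, hap]; simp

theorem star_mul_projection (hp : IsStarProjection p) (hpa : p * a = a) :
    star a * p = star a := by
  rw [← hp.isSelfAdjoint.star_eq, ← star_mul, hpa]

theorem projection_mul_star (hp : IsStarProjection p) (hap : a * p = 0) : p * star a = 0 := by
  rw [← hp.isSelfAdjoint.star_eq, ← star_mul, hap, star_zero]

theorem add_star_mul_self (hpa : p * a = a) (hap : a * p = 0) :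
    (a + star a) * (a + star a) = a * star a + star a * a := by
  have h := offDiagonal_mul_self hpa hap
  have h' : star a * star a = 0 := by rw [← star_mul, h, star_zero]
  linear_combination (norm := noncomm_ring) h + h'

theorem add_mul_star_add (hp : IsStarProjection p) (hap : a * p = 0) :
    (p + a) * star (p + a) = p + a * star a := by
  rw [star_add, hp.isSelfAdjoint.star_eq]
  linear_combination (norm := noncomm_ring) hp.isIdempotentElem.eq + hap + projection_mul_star hp hap

variable [PartialOrder M] [StarOrderedRing M]

/-- With `q = p + a`, compress `q q⋆ = p + a a⋆ ≤ ‖q‖²` by `p`. -/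
theorem offDiagonal_mul_star_le (hp : IsStarProjection p) (hpa : p * a = a) (hap : a * p = 0) :
    a * star a ≤ (‖p + a‖ ^ 2 - 1) • p := by
  have h := star_left_conjugate_le_conjugate
    (CStarAlgebra.mul_star_le_algebraMap_norm_sq (a := p + a)) p
  rw [add_mul_star_add hp hap, hp.isSelfAdjoint.star_eq, Algebra.algebraMap_eq_smul_one] at h
  have h1 : p * (p + a * star a) * p = p + a * star a := by
    have h3 := hp.isIdempotentElem.eq
    simp only [mul_add, add_mul, mul_assoc, star_mul_projection hp hpa, h3, mul_mul_of_mul_eq hpa]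
  have h2 : p * ((‖p + a‖ ^ 2) • (1 : M)) * p = (‖p + a‖ ^ 2) • p := by
    simp [hp.isIdempotentElem.eq]
  rw [h1, h2] at h
  rw [sub_smul, one_smul]
  exact le_sub_iff_add_le'.2 h

/-- The square is `a a⋆ + a⋆ a`, whose summands live in the orthogonal corners of `p` and `1 - p`,
so the bounds on the corners add up to a multiple of `1` without a factor 2. -/
theorem offDiagonal_sq_le (hp : IsStarProjection p) (hpa : p * a = a) (hap : a * p = 0)
    (h0 : 1 ≤ ‖p + a‖) :
    (a + star a) * (a + star a) ≤ algebraMap ℝ M (‖p + a‖ ^ 2 - 1) := by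
  have hr : 0 ≤ ‖p + a‖ ^ 2 - 1 := by nlinarith
  have h1 := offDiagonal_mul_star_le hp hpa hap
  -- The bound passes from `a a⋆` to `a⋆ a` because the two have the same norm.
  have hn : ‖star a * a‖ ≤ ‖p + a‖ ^ 2 - 1 := by
    rw [CStarRing.norm_star_mul_self, ← CStarRing.norm_self_mul_star,
      CStarAlgebra.norm_le_iff_le_algebraMap _ hr (mul_star_self_nonneg a),
      Algebra.algebraMap_eq_smul_one]
    exact h1.trans (smul_le_smul_of_nonneg_left hp.le_one hr)
  have h2 := (CStarAlgebra.norm_le_iff_le_algebraMap _ hr (star_mul_self_nonneg a)).1 hn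
  have h3 := star_left_conjugate_le_conjugate h2 (1 - p)
  have h4 : star (1 - p) * (star a * a) * (1 - p) = star a * a := by
    rw [star_sub, star_one, hp.isSelfAdjoint.star_eq]
    simp [mul_sub, sub_mul, mul_assoc, hap, mul_mul_of_mul_eq (projection_mul_star hp hap)]
  have h5 : star (1 - p) * (algebraMap ℝ M (‖p + a‖ ^ 2 - 1)) * (1 - p)
      = (‖p + a‖ ^ 2 - 1) • (1 - p) := by
    rw [hp.one_sub.isSelfAdjoint.star_eq, Algebra.algebraMap_eq_smul_one]
    simp only [mul_smul_comm, smul_mul_assoc, mul_one, hp.one_sub.isIdempotentElem.eq]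
  rw [h4, h5] at h3
  rw [add_star_mul_self hpa hap, Algebra.algebraMap_eq_smul_one]
  calc _ ≤ (‖p + a‖ ^ 2 - 1) • p + (‖p + a‖ ^ 2 - 1) • (1 - p) := add_le_add h1 h3
    _ = _ := by rw [← smul_add]; simp

/-- Places `‖p + a‖²` in the spectrum of `1 + a a⋆` later on. The lower estimate comes from `(p +
a)(p + a)⋆ = p (1 + a a⋆)`. -/
theorem norm_one_add_offDiagonal (hp : IsStarProjection p) (hpa : p * a = a) (hap : a * p = 0)
    (h0 : 1 ≤ ‖p + a‖) : ‖1 + a * star a‖ = ‖p + a‖ ^ 2 := by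
  have hr : 0 ≤ ‖p + a‖ ^ 2 - 1 := by nlinarith
  apply le_antisymm
  · rw [CStarAlgebra.norm_le_iff_le_algebraMap _ (by positivity)
      (add_nonneg zero_le_one (mul_star_self_nonneg a))]
    have h : a * star a ≤ algebraMap ℝ M (‖p + a‖ ^ 2 - 1) := by
      rw [Algebra.algebraMap_eq_smul_one]
      exact (offDiagonal_mul_star_le hp hpa hap).trans
        (smul_le_smul_of_nonneg_left hp.le_one hr)
    rw [map_sub, map_one] at h
    exact add_le_of_le_sub_left h
  · have h1 : p * (1 + a * star a) = p + a * star a := by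
      rw [mul_add, mul_one, mul_mul_of_mul_eq hpa]
    rw [sq, ← CStarRing.norm_self_mul_star, add_mul_star_add hp hap, ← h1]
    calc _ ≤ ‖p‖ * ‖1 + a * star a‖ := norm_mul_le _ _
      _ ≤ 1 * ‖1 + a * star a‖ := by gcongr; exact hp.norm_le
      _ = _ := one_mul _

end OffDiagonal

/-! ### Functional calculus of the square root on a spectrum in `[1, ∞)` -/

section Sqrt

variable {M : Type*} [CStarAlgebra M] {y : M}

theorem continuousOn_inv_sqrt (h1 : ∀ x ∈ spectrum ℝ y, 1 ≤ x) :
    ContinuousOn (fun x : ℝ => (√x)⁻¹) (spectrum ℝ y) :=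
  ContinuousOn.inv₀ (by fun_prop) fun x hx => (Real.sqrt_pos.2 (zero_lt_one.trans_le (h1 x hx))).ne'

theorem cfc_sqrt_mul_cfc_sqrt (hy : IsSelfAdjoint y) (h1 : ∀ x ∈ spectrum ℝ y, 1 ≤ x) :
    cfc Real.sqrt y * cfc Real.sqrt y = y := by
  rw [← cfc_mul Real.sqrt Real.sqrt y (by fun_prop) (by fun_prop)]
  conv_rhs => rw [← cfc_id' ℝ y]
  exact cfc_congr fun x hx => Real.mul_self_sqrt (zero_le_one.trans (h1 x hx))

theorem cfc_sqrt_mul_cfc_inv_sqrt (hy : IsSelfAdjoint y) (h1 : ∀ x ∈ spectrum ℝ y, 1 ≤ x) :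
    cfc Real.sqrt y * cfc (fun x : ℝ => (√x)⁻¹) y = 1 := by
  rw [← cfc_mul Real.sqrt _ y (by fun_prop) (continuousOn_inv_sqrt h1), ← cfc_const_one ℝ y]
  exact cfc_congr fun x hx =>
    mul_inv_cancel₀ (Real.sqrt_pos.2 (zero_lt_one.trans_le (h1 x hx))).ne'

theorem cfc_inv_sqrt_mul_cfc_sqrt (hy : IsSelfAdjoint y) (h1 : ∀ x ∈ spectrum ℝ y, 1 ≤ x) :
    cfc (fun x : ℝ => (√x)⁻¹) y * cfc Real.sqrt y = 1 := by
  rw [(cfc_commute_cfc _ _ y).eq, cfc_sqrt_mul_cfc_inv_sqrt hy h1]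

theorem cfc_sqrt_add_one_mul_cfc_inv (hy : IsSelfAdjoint y) :
    (cfc Real.sqrt y + 1) * cfc (fun x : ℝ => (√x + 1)⁻¹) y = 1 := by
  have hc : ContinuousOn (fun x : ℝ => (√x + 1)⁻¹) (spectrum ℝ y) :=
    ContinuousOn.inv₀ (by fun_prop) fun x _ => by positivity
  rw [← cfc_const_one ℝ y, ← cfc_add _ Real.sqrt (fun _ => 1) (by fun_prop) (by fun_prop),
    ← cfc_mul (fun x => √x + 1) _ _ (by fun_prop) hc]
  exact cfc_congr fun x _ => mul_inv_cancel₀ (by positivity)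

theorem norm_cfc_sqrt_sub_one_le (hy : IsSelfAdjoint y) {r : ℝ} (hr : 1 ≤ r)
    (h1 : ∀ x ∈ spectrum ℝ y, 1 ≤ x ∧ x ≤ r ^ 2) : ‖cfc Real.sqrt y - 1‖ ≤ r - 1 := by
  rw [← cfc_const_one ℝ y, ← cfc_sub Real.sqrt (fun _ => 1) y (by fun_prop) (by fun_prop)]
  refine norm_cfc_le (by linarith) fun x hx => ?_
  obtain ⟨hx1, hx2⟩ := h1 x hx
  have hs1 : 1 ≤ √x := Real.one_le_sqrt.2 hx1
  have hs2 : √x ≤ r := (Real.sqrt_le_left (by linarith)).2 hx2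
  rw [Real.norm_of_nonneg (by linarith)]
  linarith

end Sqrt

/-! ### The upper bound -/

section Norm

variable {M : Type*} [CStarAlgebra M] {p a : M}

theorem isSelfAdjoint_one_add_sq (a : M) :
    IsSelfAdjoint (1 + (a + star a) * (a + star a)) :=
  .add (.one M) (by
    have h : IsSelfAdjoint (a + star a) := .add_star_self a
    simpa [h.star_eq] using IsSelfAdjoint.star_mul_self (a + star a))

theorem commute_one_add_sq_projection (hp : IsStarProjection p) (hpa : p * a = a)
    (hap : a * p = 0) : Commute (1 + (a + star a) * (a + star a)) p := by
  rw [add_star_mul_self hpa hap]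
  simp only [commute_iff_eq, add_mul, mul_add, mul_assoc, one_mul, mul_one, hap, mul_zero,
    star_mul_projection hp hpa, mul_mul_of_mul_eq hpa,
    mul_mul_of_mul_eq (projection_mul_star hp hap), zero_mul]

variable [PartialOrder M] [StarOrderedRing M]

theorem spectrum_one_add_sq (hp : IsStarProjection p) (hpa : p * a = a) (hap : a * p = 0)
    (h0 : 1 ≤ ‖p + a‖) {x : ℝ} (hx : x ∈ spectrum ℝ (1 + (a + star a) * (a + star a))) :
    1 ≤ x ∧ x ≤ ‖p + a‖ ^ 2 := by
  have hs := isSelfAdjoint_one_add_sq a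
  have hT : 0 ≤ (a + star a) * (a + star a) := by
    have h : IsSelfAdjoint (a + star a) := .add_star_self a
    simpa [h.star_eq] using star_mul_self_nonneg (a + star a)
  constructor
  · refine (algebraMap_le_iff_le_spectrum hs).1 ?_ x hx
    simpa using hT
  · refine (le_algebraMap_iff_spectrum_le hs).1 ?_ x hx
    have h := offDiagonal_sq_le hp hpa hap h0
    rw [map_sub, map_one] at h
    exact add_le_of_le_sub_left h

/-- The two summands are estimated separately through `x⋆ x`: with `G² = s²`, the first gives `(s⁻¹
- 1) s² (s⁻¹ - 1) = (s - 1)²`, and the second gives `(a + a⋆)²`. -/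
theorem norm_sub_le_of_offDiagonal (hp : IsStarProjection p) (hpa : p * a = a) (hap : a * p = 0)
    (h0 : 1 ≤ ‖p + a‖) :
    ‖(2 * p - 1 + (a + star a)) *
        (cfc (fun x : ℝ => (√x)⁻¹) (1 + (a + star a) * (a + star a)) - 1) - (a - star a)‖
      ≤ ‖p + a‖ - 1 + √(‖p + a‖ ^ 2 - 1) := by
  have hys := isSelfAdjoint_one_add_sq a
  have hsp : ∀ x ∈ spectrum ℝ (1 + (a + star a) * (a + star a)), 1 ≤ x ∧ x ≤ ‖p + a‖ ^ 2 :=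
    fun x hx => spectrum_one_add_sq hp hpa hap h0 hx
  have haa := offDiagonal_mul_self hpa hap
  have haa' : star a * star a = 0 := by rw [← star_mul, haa, star_zero]
  have hpa' := projection_mul_star hp hap
  have hap' := star_mul_projection hp hpa
  have hpp := hp.isIdempotentElem.eq
  -- The cross terms cancel because `2p - 1` anticommutes with `a + a⋆`.
  have hGG : (2 * p - 1 + (a + star a)) * (2 * p - 1 + (a + star a)) =
      1 + (a + star a) * (a + star a) := by
    simp only [two_mul, add_mul, mul_add, sub_mul, mul_sub, hpp, hpa, hap, hpa', hap', haa, haa',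
      one_mul, mul_one]
    abel
  have hGs : IsSelfAdjoint (2 * p - 1 + (a + star a)) := by
    have := hp.isSelfAdjoint
    rw [two_mul]
    exact ((this.add this).sub (.one M)).add (.add_star_self a)
  refine (norm_sub_le _ _).trans (add_le_add ?_ ?_)
  · generalize 1 + (a + star a) * (a + star a) = y at *
    refine (sq_le_sq₀ (norm_nonneg _) (by linarith)).1 ?_
    have his : IsSelfAdjoint (cfc (fun x : ℝ => (√x)⁻¹) y) := cfc_predicate _ _
    have hss : IsSelfAdjoint (cfc Real.sqrt y) := cfc_predicate _ _
    have h1 := cfc_sqrt_mul_cfc_sqrt hys fun x hx => (hsp x hx).1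
    have h2 := cfc_sqrt_mul_cfc_inv_sqrt hys fun x hx => (hsp x hx).1
    have h3 := cfc_inv_sqrt_mul_cfc_sqrt hys fun x hx => (hsp x hx).1
    have h4 := norm_cfc_sqrt_sub_one_le hys h0 hsp
    generalize cfc Real.sqrt y = s at *
    generalize cfc (fun x : ℝ => (√x)⁻¹) y = i at *
    have h5 : star ((2 * p - 1 + (a + star a)) * (i - 1)) *
        ((2 * p - 1 + (a + star a)) * (i - 1)) = star (s - 1) * (s - 1) := by
      rw [star_mul, hGs.star_eq, mul_assoc, ← mul_assoc _ _ (i - 1), hGG, ← h1, star_sub, star_sub,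
        his.star_eq, hss.star_eq, star_one]
      simp only [sub_mul, mul_sub, mul_assoc, h2, h3, mul_mul_of_mul_eq h3, one_mul, mul_one]
      abel
    rw [sq, ← CStarRing.norm_star_mul_self, h5, CStarRing.norm_star_mul_self, ← sq]
    gcongr
  · refine Real.le_sqrt_of_sq_le ?_
    rw [sq, ← CStarRing.norm_star_mul_self]
    have h1 : star (a - star a) * (a - star a) = (a + star a) * (a + star a) := by
      rw [star_sub, star_star]
      linear_combination (norm := noncomm_ring) -2 * haa - 2 * haa'
    rw [h1, CStarAlgebra.norm_le_iff_le_algebraMap _ (by nlinarith)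
      (h1 ▸ star_mul_self_nonneg (a - star a))]
    exact offDiagonal_sq_le hp hpa hap h0

/-- `1 + (a + a⋆)²` is block diagonal, with the same `p` corner as `1 + a a⋆`, while the latter is
the identity on the other corner. The right-hand side is therefore a positive square root of `1 + a
a⋆`, and such a root is unique. -/
theorem cfc_sqrt_one_add_mul_star (hp : IsStarProjection p) (hpa : p * a = a) (hap : a * p = 0)
    (h0 : 1 ≤ ‖p + a‖) :
    cfc Real.sqrt (1 + a * star a) =
      p * cfc Real.sqrt (1 + (a + star a) * (a + star a)) + (1 - p) := by
  have hys := isSelfAdjoint_one_add_sq a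
  have hsp : ∀ x ∈ spectrum ℝ (1 + (a + star a) * (a + star a)), 1 ≤ x :=
    fun x hx => (spectrum_one_add_sq hp hpa hap h0 hx).1
  have hpp := hp.isIdempotentElem.eq
  have hcp := (commute_one_add_sq_projection hp hpa hap).cfc_real Real.sqrt
  have hss := cfc_sqrt_mul_cfc_sqrt hys hsp
  have hs0 : 0 ≤ cfc Real.sqrt (1 + (a + star a) * (a + star a)) :=
    cfc_nonneg fun x _ => Real.sqrt_nonneg x
  generalize cfc Real.sqrt (1 + (a + star a) * (a + star a)) = s at *
  have hb0 : 0 ≤ p * s + (1 - p) := by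
    refine add_nonneg ?_ hp.one_sub_nonneg
    have h := star_left_conjugate_nonneg hs0 p
    rwa [hp.isSelfAdjoint.star_eq, mul_assoc, hcp.eq, ← mul_assoc, hpp] at h
  have hbb : (p * s + (1 - p)) * (p * s + (1 - p)) = 1 + a * star a := by
    have hpsp := mul_mul_of_mul_eq hcp.eq.symm
    have h2 : p * (s * s) = p + a * star a := by
      rw [hss, add_star_mul_self hpa hap, mul_add, mul_add, mul_mul_of_mul_eq hpa,
        mul_mul_of_mul_eq (projection_mul_star hp hap)]
      simp
    have h3 : (p * s + (1 - p)) * (p * s + (1 - p)) = p * (s * s) + (1 - p) := by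
      simp only [mul_add, add_mul, mul_sub, sub_mul, mul_one, one_mul, mul_assoc, hcp.eq,
        mul_mul_of_mul_eq hcp.eq, hpp, mul_mul_of_mul_eq hpp]
      abel
    rw [h3, h2]
    abel
  rw [← cfcₙ_eq_cfc (hf0 := Real.sqrt_zero), ← CFC.sqrt_eq_real_sqrt _ (by
    exact add_nonneg zero_le_one (mul_star_self_nonneg a))]
  exact CFC.sqrt_unique hbb hb0

end Norm

/-! ### The eigenvector for the lower bound -/

section LowerBound

variable {M : Type*} [CStarAlgebra M] {p a : M}

/-- With `G = 2p - 1 + a + a⋆` and `F = a - a⋆`, everything commutes with `i`, so the product is `G²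
(i - 1)² + (i - 1)(G F - F G) - F²`. Here `G² = s²`, `F² = 1 - s²`, and the commutator of `G` and
`F` is `-2K` with `K = (2p - 1)(a a⋆ + a⋆ a) - (a + a⋆)`. -/
theorem sub_mul_star_sub (hp : IsStarProjection p) (hpa : p * a = a) (hap : a * p = 0) {s i : M}
    (his : IsSelfAdjoint i) (hss : s * s = 1 + (a + star a) * (a + star a)) (hsi : s * i = 1)
    (hip : Commute i p) (hia : Commute i (a + star a)) :
    ((2 * p - 1 + (a + star a)) * (i - 1) - (a - star a)) *
      star ((2 * p - 1 + (a + star a)) * (i - 1) - (a - star a)) =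
    2 * (s * s) - 2 * s + 2 * (1 - i) * ((2 * p - 1) * (a * star a + star a * a) - (a + star a)) := by
  have haa := offDiagonal_mul_self hpa hap
  have haa' : star a * star a = 0 := by rw [← star_mul, haa, star_zero]
  have hpa' := projection_mul_star hp hap
  have hap' := star_mul_projection hp hpa
  have hpp := hp.isIdempotentElem.eq
  have hia1 : Commute i a := by
    have h : p * (a + star a) = a := by rw [mul_add, hpa, hpa', add_zero]
    rw [← h]
    exact hip.mul_right hia
  have hia2 : Commute i (star a) := by simpa using hia.sub_right hia1
  have hGG : (2 * p - 1 + (a + star a)) * (2 * p - 1 + (a + star a)) = s * s := by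
    rw [hss]
    simp only [two_mul, add_mul, mul_add, sub_mul, mul_sub, hpp, hpa, hap, hpa', hap', haa, haa',
      one_mul, mul_one]
    abel
  have hGs : star (2 * p - 1 + (a + star a)) = 2 * p - 1 + (a + star a) := by
    simp [two_mul, hp.isSelfAdjoint.star_eq, add_comm]
  have hGi : Commute i (2 * p - 1 + (a + star a)) := by
    rw [two_mul]
    exact ((hip.add_right hip).sub_right (.one_right i)).add_right hia
  have hF : (a - star a) * (a - star a) = 1 - s * s := by
    rw [hss, add_star_mul_self hpa hap]
    linear_combination (norm := noncomm_ring) haa + haa'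
  have hGF : (2 * p - 1 + (a + star a)) * (a - star a) - (a - star a) * (2 * p - 1 + (a + star a))
      = -2 * ((2 * p - 1) * (a * star a + star a * a) - (a + star a)) := by
    simp only [two_mul, add_mul, mul_add, sub_mul, mul_sub, hpa, hap, hpa', hap', haa, haa',
      one_mul, mul_one, neg_mul, mul_mul_of_mul_eq hpa, mul_mul_of_mul_eq hpa', zero_mul]
    abel
  have hiF : Commute i (a - star a) := hia1.sub_right hia2
  rw [star_sub, star_mul, star_sub, star_sub, star_star, his.star_eq, star_one, hGs]
  generalize 2 * p - 1 + (a + star a) = G at *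
  generalize (2 * p - 1) * (a * star a + star a * a) - (a + star a) = K at *
  have hF2 : star a - a = -(a - star a) := by abel
  rw [hF2]
  generalize a - star a = F at *
  have e1 : (G * (i - 1) - F) * ((i - 1) * G - -F) =
      (G * G) * ((i - 1) * (i - 1)) + (i - 1) * (G * F - F * G) - F * F := by
    simp only [mul_sub, sub_mul, sub_neg_eq_add, mul_one, one_mul, mul_add, mul_assoc, ← hGi.eq,
      mul_mul_of_mul_eq hGi.eq.symm, mul_mul_of_mul_eq hiF.eq.symm]
    abel
  rw [e1, hGG, hGF, hF]
  have e2 : s * s * ((i - 1) * (i - 1)) = 1 - 2 * s + s * s := by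
    simp only [mul_sub, sub_mul, mul_one, one_mul, mul_assoc, hsi, mul_mul_of_mul_eq hsi, two_mul]
    abel
  rw [e2]
  noncomm_ring

/-- For `β² = a a⋆` and `b = √(1 + a a⋆)`, the element `(β + b) β - a⋆` is an eigenvector of
`(2 p - 1) T² - T`, where `T = a + a⋆`, with eigenvalue `b β`. -/
theorem mul_eigenvector (hp : IsStarProjection p) (hpa : p * a = a) (hap : a * p = 0)
    {s i b β : M} (hss : s * s = 1 + (a + star a) * (a + star a)) (hi : i * s = 1)
    (hsp : Commute s p) (hsa : Commute s (star a)) (hb : b = p * s + (1 - p)) (hpβ : p * β = β)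
    (hββ : β * β = a * star a) (hbβ : Commute b β) :
    (2 * (s * s) - 2 * s + 2 * (1 - i) * ((2 * p - 1) * (a * star a + star a * a) - (a + star a)))
      * ((β + b) * β - star a) =
      ((β + b) * β - star a) * (2 * (b * b - b + b * β - β)) := by
  have haa := offDiagonal_mul_self hpa hap
  have haa' : star a * star a = 0 := by rw [← star_mul, haa, star_zero]
  have hpa' := projection_mul_star hp hap
  have hap' := star_mul_projection hp hpa
  have hpp := hp.isIdempotentElem.eq
  have hsβ : s * β = b * β := by
    rw [hb, ← hpβ]
    simp only [add_mul, sub_mul, one_mul, mul_assoc, mul_mul_of_mul_eq hpp,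
      mul_mul_of_mul_eq hsp.eq]
    abel
  have hsa' : s * star a = star a * b := by
    rw [hb]
    simp only [mul_add, mul_sub, mul_mul_of_mul_eq hap', hsa.eq, hap', mul_one]
    abel
  have hbb : b * b = 1 + β * β := by
    have h : p * (s * s) = p + a * star a := by
      rw [hss, add_star_mul_self hpa hap, mul_add, mul_add, mul_mul_of_mul_eq hpa,
        mul_mul_of_mul_eq hpa', mul_one, zero_mul, add_zero]
    have h3 : b * b = p * (s * s) + (1 - p) := by
      rw [hb]
      simp only [mul_add, add_mul, mul_sub, sub_mul, mul_one, one_mul, mul_assoc, hsp.eq,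
        mul_mul_of_mul_eq hsp.eq, hpp, mul_mul_of_mul_eq hpp]
      abel
    rw [h3, h, hββ]
    abel
  -- Left multiplication by `s` on the eigenvector becomes right multiplication by `b`; this turns
  -- every function of `s` into a function of `b`.
  have hsw : s * ((β + b) * β - star a) = ((β + b) * β - star a) * b := by
    have e : (β + b) * β = β * (β + b) := by rw [add_mul, mul_add, hbβ.eq]
    rw [mul_sub, sub_mul, hsa', e, ← mul_assoc, hsβ]
    have e2 : Commute b (β * (β + b)) := hbβ.mul_right (hbβ.add_right (.refl b))
    rw [mul_assoc b, e2.eq]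
  have haβ : a * β = 0 := by rw [← hpβ, ← mul_assoc, hap, zero_mul]
  have haw : (a * star a + star a * a) * ((β + b) * β - star a)
      = β * β * ((β + b) * β) - star a * (β * β) := by
    have e : (β + b) * β = β * (β + b) := by rw [add_mul, mul_add, hbβ.eq]
    rw [hββ, e]
    simp only [add_mul, mul_sub, mul_assoc, mul_mul_of_mul_eq haβ, haa', mul_zero, zero_mul]
    abel
  have hTw : (a + star a) * ((β + b) * β - star a) = star a * ((β + b) * β) - β * β := by
    have e : (β + b) * β = β * (β + b) := by rw [add_mul, mul_add, hbβ.eq]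
    rw [hββ, e]
    simp only [add_mul, mul_sub, mul_mul_of_mul_eq haβ, haa', zero_mul]
    abel
  have hKw : ((2 * p - 1) * (a * star a + star a * a) - (a + star a)) * ((β + b) * β - star a)
      = ((β + b) * β - star a) * (b * β) := by
    rw [sub_mul, mul_assoc, haw, hTw]
    simp only [two_mul, add_mul, mul_sub, sub_mul, mul_add, one_mul, mul_assoc,
      mul_mul_of_mul_eq hpβ, mul_mul_of_mul_eq hpa', zero_mul, hbβ.eq, mul_mul_of_mul_eq hbβ.eq, hbb,
      mul_one]
    abel
  have hiw : i * (((β + b) * β - star a) * (b * β)) = ((β + b) * β - star a) * β := by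
    rw [← mul_assoc _ b β, ← hsw, mul_assoc s, ← mul_assoc i, hi, one_mul]
  have hw : (2 * (s * s) - 2 * s +
      2 * (1 - i) * ((2 * p - 1) * (a * star a + star a * a) - (a + star a))) *
      ((β + b) * β - star a) =
      2 * (s * (s * ((β + b) * β - star a))) - 2 * (s * ((β + b) * β - star a)) +
      2 * (((2 * p - 1) * (a * star a + star a * a) - (a + star a)) * ((β + b) * β - star a)
       - i * (((2 * p - 1) * (a * star a + star a * a) - (a + star a)) *
          ((β + b) * β - star a))) := by
    generalize (2 * p - 1) * (a * star a + star a * a) - (a + star a) = K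
    noncomm_ring
  rw [hw, hKw, hiw, hsw, ← mul_assoc s, hsw]
  noncomm_ring

/-- The cross terms vanish since `a β = a p β = 0`. What remains involves only `b` and `β`, hence
will be a function of `1 + a a⋆`. -/
theorem star_eigenvector_mul (hap : a * p = 0) {b β : M}
    (hpβ : p * β = β) (hbs : IsSelfAdjoint b) (hβs : IsSelfAdjoint β)
    (hββ : β * β = a * star a) (hbβ : Commute b β) :
    star ((β + b) * β - star a) * ((β + b) * β - star a) =
      (β + b) * β * ((β + b) * β) + β * β := by
  have e : (β + b) * β = β * (β + b) := by rw [add_mul, mul_add, hbβ.eq]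
  have haβ : a * β = 0 := by rw [← hpβ, ← mul_assoc, hap, zero_mul]
  have h1 : a * ((β + b) * β) = 0 := by rw [e, ← mul_assoc, haβ, zero_mul]
  have hs : IsSelfAdjoint ((β + b) * β) := by
    rw [IsSelfAdjoint, star_mul, star_add, hβs.star_eq, hbs.star_eq, e]
  have h2 : (β + b) * β * star a = 0 := by
    simpa [hs.star_eq] using congrArg star h1
  rw [star_sub, star_star, hs.star_eq, sub_mul, mul_sub, mul_sub, h1, h2, hββ]
  abel

end LowerBound

theorem Adjointable.mul_eq_of_range_subset {A E : Type*} [NonUnitalCStarAlgebra A]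
    [PartialOrder A] [StarOrderedRing A] [NormedAddCommGroup E] [NormedSpace ℂ E] [SMul A E]
    [CStarModule A E] {P Q : Adjointable A E} (hP : IsIdempotentElem P)
    (h : Set.range Q.toCLM ⊆ Set.range P.toCLM) : P * Q = Q := by
  refine Adjointable.toCLM_injective (ContinuousLinearMap.ext fun x => ?_)
  obtain ⟨y, hy⟩ := h ⟨x, rfl⟩
  rw [Adjointable.toCLM_mul, ← hy, ← Adjointable.toCLM_mul, hP.eq]

/-! ### The lower bound and the block formula -/

section Main

variable {M : Type*} [CStarAlgebra M] [PartialOrder M] [StarOrderedRing M] {p a : M}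

theorem spectrum_one_add_mul_star {x : ℝ} (hx : x ∈ spectrum ℝ (1 + a * star a)) : 1 ≤ x := by
  have hs : IsSelfAdjoint (1 + a * star a) := .add (.one M) (.mul_star_self a)
  refine (algebraMap_le_iff_le_spectrum hs).1 ?_ x hx
  simp

/-- Conjugating `e e⋆ ≤ ‖e‖²` by `w` gives `f g ≤ ‖e‖² f` in the functional calculus of `z`, hence
pointwise on the spectrum; then divide by `f x`. -/
theorem eigenvalue_le_of_star_mul_le {z e w : M} (hz : IsSelfAdjoint z) {f g : ℝ → ℝ}
    (hf : ContinuousOn f (spectrum ℝ z)) (hg : ContinuousOn g (spectrum ℝ z))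
    (hw : star w * w = cfc f z) (hew : e * star e * w = w * cfc g z)
    {x : ℝ} (hx : x ∈ spectrum ℝ z) (hfx : 0 < f x) : g x ≤ ‖e‖ ^ 2 := by
  have h := CStarAlgebra.star_left_conjugate_le_norm_smul (a := w) (IsSelfAdjoint.mul_star_self e)
  rw [mul_assoc, hew, ← mul_assoc, hw, ← cfc_mul f g z hf hg, ← cfc_smul ‖e * star e‖ f z hf,
    cfc_le_iff (fun x => f x * g x) (fun x => ‖e * star e‖ • f x) z (hf.mul hg)
      (continuousOn_const.mul hf) hz] at h
  have h1 := h x hx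
  rw [smul_eq_mul, mul_comm] at h1
  rw [sq, ← CStarRing.norm_self_mul_star]
  exact le_of_mul_le_mul_right h1 hfx

theorem le_norm_sub_of_offDiagonal [Nontrivial M] (hp : IsStarProjection p) (hpa : p * a = a)
    (hap : a * p = 0) (h0 : 1 ≤ ‖p + a‖) :
    ‖p + a‖ - 1 + √(‖p + a‖ ^ 2 - 1) ≤
    ‖(2 * p - 1 + (a + star a)) *
        (cfc (fun x : ℝ => (√x)⁻¹) (1 + (a + star a) * (a + star a)) - 1) - (a - star a)‖ := by
  rcases h0.eq_or_lt with h1 | h1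
  -- If the norm is 1 the left side is 0. Otherwise `‖p + a‖² - 1 > 0`, which makes `w⋆ w` positive
  -- at the spectral value used below.
  · simp [← h1]
  have hys := isSelfAdjoint_one_add_sq a
  have hsp : ∀ x ∈ spectrum ℝ (1 + (a + star a) * (a + star a)), 1 ≤ x :=
    fun x hx => (spectrum_one_add_sq hp hpa hap h0 hx).1
  have hyp := commute_one_add_sq_projection hp hpa hap
  have hyT : Commute (1 + (a + star a) * (a + star a)) (a + star a) := by
    rw [commute_iff_eq]; noncomm_ring
  have hpT : (a + star a) * p = star a := by
    rw [add_mul, hap, star_mul_projection hp hpa, zero_add]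
  have hya : Commute (1 + (a + star a) * (a + star a)) (star a) := by
    conv => enter [2]; rw [← hpT]
    exact hyT.mul_right hyp
  have hee := sub_mul_star_sub hp hpa hap (cfc_predicate (fun x : ℝ => (√x)⁻¹) _)
    (cfc_sqrt_mul_cfc_sqrt hys hsp) (cfc_sqrt_mul_cfc_inv_sqrt hys hsp) (hyp.cfc_real _)
    (hyT.cfc_real _)
  have hb := cfc_sqrt_one_add_mul_star hp hpa hap h0
  set z := 1 + a * star a with hz
  have hzs : IsSelfAdjoint z := .add (.one M) (.mul_star_self a)
  have hzsp : ∀ x ∈ spectrum ℝ z, 1 ≤ x := fun x hx => spectrum_one_add_mul_star hx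
  have hβs : IsSelfAdjoint (cfc (fun x : ℝ => √(x - 1)) z) := cfc_predicate _ _
  have hbs : IsSelfAdjoint (cfc Real.sqrt z) := cfc_predicate _ _
  have hββ : cfc (fun x : ℝ => √(x - 1)) z * cfc (fun x : ℝ => √(x - 1)) z = a * star a := by
    rw [← cfc_mul (fun x : ℝ => √(x - 1)) (fun x : ℝ => √(x - 1)) z (by fun_prop) (by fun_prop)]
    have h : cfc (fun x : ℝ => x - 1) z = a * star a := by
      rw [cfc_sub (fun x => x) (fun _ => 1) z (by fun_prop) (by fun_prop), cfc_id' ℝ z,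
        cfc_const_one ℝ z, hz, add_sub_cancel_left]
    rw [← h]
    exact cfc_congr fun x hx => Real.mul_self_sqrt (sub_nonneg.2 (hzsp x hx))
  -- `β² = a a⋆` is killed by `1 - p`, hence so is `β`.
  have hβp : cfc (fun x : ℝ => √(x - 1)) z * (1 - p) = 0 := by
    rw [← CStarRing.star_mul_self_eq_zero_iff, star_mul, hβs.star_eq, mul_assoc,
      ← mul_assoc (cfc _ z), hββ, hp.one_sub.isSelfAdjoint.star_eq, ← mul_assoc, ← mul_assoc,
      sub_mul, hpa, one_mul, sub_self, zero_mul, zero_mul]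
  have hpβ : p * cfc (fun x : ℝ => √(x - 1)) z = cfc (fun x : ℝ => √(x - 1)) z := by
    have h := congrArg star hβp
    rw [star_mul, hβs.star_eq, hp.one_sub.isSelfAdjoint.star_eq, sub_mul, one_mul, star_zero] at h
    exact (sub_eq_zero.1 h).symm
  have hbβ := cfc_commute_cfc Real.sqrt (fun x : ℝ => √(x - 1)) z
  have hew := mul_eigenvector hp hpa hap (cfc_sqrt_mul_cfc_sqrt hys hsp)
    (cfc_inv_sqrt_mul_cfc_sqrt hys hsp) (hyp.cfc_real _) (hya.cfc_real _) hb hpβ hββ hbβ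
  have hww := star_eigenvector_mul hap hpβ hbs hβs hββ hbβ
  rw [← hee] at hew
  have hN : ‖p + a‖ ^ 2 ∈ spectrum ℝ z := by
    rw [← norm_one_add_offDiagonal hp hpa hap h0]
    exact CStarAlgebra.norm_mem_spectrum_of_nonneg
      (add_nonneg zero_le_one (mul_star_self_nonneg a))
  have hf : cfc (fun x : ℝ => (√(x - 1) + √x) * √(x - 1) * ((√(x - 1) + √x) * √(x - 1)) +
      √(x - 1) * √(x - 1)) z = star ((cfc (fun x : ℝ => √(x - 1)) z + cfc Real.sqrt z) *
        cfc (fun x : ℝ => √(x - 1)) z - star a) *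
        ((cfc (fun x : ℝ => √(x - 1)) z + cfc Real.sqrt z) *
        cfc (fun x : ℝ => √(x - 1)) z - star a) := by
    rw [hww, ← cfc_add _ (fun x : ℝ => √(x - 1)) Real.sqrt (by fun_prop) (by fun_prop),
      ← cfc_mul (fun x => √(x - 1) + √x) (fun x : ℝ => √(x - 1)) z (by fun_prop) (by fun_prop),
      ← cfc_mul (fun x => (√(x - 1) + √x) * √(x - 1)) (fun x : ℝ => (√(x - 1) + √x) * √(x - 1)) z
        (by fun_prop) (by fun_prop),
      ← cfc_mul (fun x => √(x - 1)) (fun x : ℝ => √(x - 1)) z (by fun_prop) (by fun_prop),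
      ← cfc_add z (fun x => (√(x - 1) + √x) * √(x - 1) * ((√(x - 1) + √x) * √(x - 1)))
        (fun x : ℝ => √(x - 1) * √(x - 1)) (by fun_prop) (by fun_prop)]
  have hg : cfc (fun x : ℝ => (2 : ℝ) • (√x * √x - √x + √x * √(x - 1) - √(x - 1))) z =
      2 * (cfc Real.sqrt z * cfc Real.sqrt z - cfc Real.sqrt z +
        cfc Real.sqrt z * cfc (fun x : ℝ => √(x - 1)) z - cfc (fun x : ℝ => √(x - 1)) z) := by
    rw [cfc_smul (2 : ℝ) _ z (by fun_prop),
      cfc_sub (fun x => √x * √x - √x + √x * √(x - 1)) (fun x => √(x - 1)) z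
        (by fun_prop) (by fun_prop),
      cfc_add z (fun x => √x * √x - √x) (fun x => √x * √(x - 1)) (by fun_prop) (by fun_prop),
      cfc_sub (fun x => √x * √x) (fun x => √x) z (by fun_prop) (by fun_prop),
      cfc_mul (fun x => √x) (fun x => √x) z (by fun_prop) (by fun_prop),
      cfc_mul (fun x => √x) (fun x => √(x - 1)) z (by fun_prop) (by fun_prop), two_smul, two_mul]
  rw [← hg] at hew
  have hα : 0 < ‖p + a‖ ^ 2 - 1 := by nlinarith
  have hα' := Real.sqrt_pos.2 hα
  have key := eigenvalue_le_of_star_mul_le hzs (by fun_prop) (by fun_prop) hf.symm hew hN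
    (by positivity)
  -- With `N = ‖p + a‖` and `α² = N² - 1`, the eigenvalue `2(N² - N + Nα - α)` equals `(N - 1 +
  -- α)²`.
  refine le_of_sq_le_sq (le_trans (le_of_eq ?_) key) (norm_nonneg _)
  rw [Real.sqrt_sq (norm_nonneg _), smul_eq_mul]
  linear_combination Real.sq_sqrt hα.le

/-- The block formula for the matched projection of `p + a`, where `p a = a` and `a p = 0`. -/
theorem matched_block_formula (hp : IsStarProjection p) (hpa : p * a = a) (hap : a * p = 0)
    (h0 : 1 ≤ ‖p + a‖) :
    p * ((cfc Real.sqrt (a * star a + 1) + 1) * Ring.inverse (cfc Real.sqrt (a * star a + 1))) * p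
      + p * (Ring.inverse (cfc Real.sqrt (a * star a + 1)) * a) * (1 - p)
      + (1 - p) * (star a * Ring.inverse (cfc Real.sqrt (a * star a + 1))) * p
      + (1 - p) * (star a * Ring.inverse (cfc Real.sqrt (a * star a + 1) *
          (cfc Real.sqrt (a * star a + 1) + 1)) * a) * (1 - p) - 2 * (p + a) =
    (2 * p - 1 + (a + star a)) *
        (cfc (fun x : ℝ => (√x)⁻¹) (1 + (a + star a) * (a + star a)) - 1) - (a - star a) := by
  have hys := isSelfAdjoint_one_add_sq a
  have hsp : ∀ x ∈ spectrum ℝ (1 + (a + star a) * (a + star a)), 1 ≤ x :=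
    fun x hx => (spectrum_one_add_sq hp hpa hap h0 hx).1
  have hyp := commute_one_add_sq_projection hp hpa hap
  have hyT : Commute (1 + (a + star a) * (a + star a)) (a + star a) := by
    rw [commute_iff_eq]; noncomm_ring
  have hpT : p * (a + star a) = a := by
    rw [mul_add, hpa, projection_mul_star hp hap, add_zero]
  have hya : Commute (1 + (a + star a) * (a + star a)) a := by
    conv => enter [2]; rw [← hpT]
    exact hyp.mul_right hyT
  have hss := cfc_sqrt_mul_cfc_sqrt hys hsp
  have hsi := cfc_sqrt_mul_cfc_inv_sqrt hys hsp
  have his := cfc_inv_sqrt_mul_cfc_sqrt hys hsp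
  have hsj := cfc_sqrt_add_one_mul_cfc_inv hys
  have hcj := cfc_commute_cfc Real.sqrt (fun x : ℝ => (√x + 1)⁻¹)
    (1 + (a + star a) * (a + star a))
  have hci := cfc_commute_cfc (fun x : ℝ => (√x)⁻¹) (fun x : ℝ => (√x + 1)⁻¹)
    (1 + (a + star a) * (a + star a))
  have hps := (hyp.cfc_real Real.sqrt).eq
  have hpi := (hyp.cfc_real fun x : ℝ => (√x)⁻¹).eq
  have hpj := (hyp.cfc_real fun x : ℝ => (√x + 1)⁻¹).eq
  have hai := (hya.cfc_real fun x : ℝ => (√x)⁻¹).eq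
  have haj := (hya.cfc_real fun x : ℝ => (√x + 1)⁻¹).eq
  rw [add_comm (a * star a) 1, cfc_sqrt_one_add_mul_star hp hpa hap h0]
  generalize cfc Real.sqrt (1 + (a + star a) * (a + star a)) = s at *
  generalize cfc (fun x : ℝ => (√x)⁻¹) (1 + (a + star a) * (a + star a)) = i at *
  generalize cfc (fun x : ℝ => (√x + 1)⁻¹) (1 + (a + star a) * (a + star a)) = j at *
  have hpp := hp.isIdempotentElem.eq
  have hpa' := projection_mul_star hp hap
  have hap' := star_mul_projection hp hpa
  have hcj' : j * s = s * j := hcj.eq.symm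
  have hjs : j * (s + 1) = 1 := by rw [mul_add, hcj', mul_one, ← hsj, add_mul, one_mul]
  have hij : (s + 1) * (i * j) = i := by rw [hci.eq, ← mul_assoc, hsj, one_mul]
  have hji : i * j * (s + 1) = i := by rw [mul_assoc, hjs, mul_one]
  have e1 : Ring.inverse (p * s + (1 - p)) = p * i + (1 - p) := by
    apply ringInverse_eq_of_mul_eq_one
    · simp only [mul_add, add_mul, mul_sub, sub_mul, mul_one, one_mul, mul_assoc, hps,
        mul_mul_of_mul_eq hps, hpp, mul_mul_of_mul_eq hpp, hsi]
      abel
    · simp only [mul_add, add_mul, mul_sub, sub_mul, mul_one, one_mul, mul_assoc, hpi,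
        mul_mul_of_mul_eq hpi, hpp, mul_mul_of_mul_eq hpp, his]
      abel
  have e2 : (p * s + (1 - p)) * (p * s + (1 - p) + 1) = p * (s * (s + 1)) + 2 * (1 - p) := by
    rw [two_mul]
    simp only [mul_add, add_mul, mul_sub, sub_mul, mul_one, one_mul, mul_assoc, hps,
      mul_mul_of_mul_eq hps, hpp, mul_mul_of_mul_eq hpp]
    abel
  have hq : p * (1 - p) = 0 := hp.mul_one_sub_self
  have hq' : (1 - p) * p = 0 := hp.one_sub_mul_self
  have hqq := hp.one_sub.isIdempotentElem.eq
  -- On the corner of `1 - p` the operator `b` is 1, so `b (b + 1)` is 2 there, whence the `2⁻¹`.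
  have e3 : Ring.inverse (p * (s * (s + 1)) + 2 * (1 - p)) =
      p * (i * j) + (2⁻¹ : ℂ) • (1 - p) := by
    have h2 : (2 : M) * (1 - p) = (2 : ℂ) • (1 - p) := by rw [two_mul, two_smul]
    have hpS : s * (s + 1) * p = p * (s * (s + 1)) := by
      simp only [mul_add, add_mul, mul_one, mul_assoc, hps, mul_mul_of_mul_eq hps]
    have hpJ : i * j * p = p * (i * j) := by
      simp only [mul_assoc, hpj, mul_mul_of_mul_eq hpi]
    have hSJ : s * (s + 1) * (i * j) = 1 := by rw [mul_assoc, hij, hsi]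
    have hJS : i * j * (s * (s + 1)) = 1 := by
      rw [show s * (s + 1) = (s + 1) * s by rw [mul_add, add_mul, mul_one, one_mul], ← mul_assoc,
        hji, his]
    rw [h2]
    generalize s * (s + 1) = S at *
    generalize i * j = J at *
    generalize hr : 1 - p = r at *
    have hpr : p + r = 1 := by rw [← hr]; abel
    have hSr : S * r = r * S := by rw [← hr, mul_sub, sub_mul, hpS, mul_one, one_mul]
    have hJr : J * r = r * J := by rw [← hr, mul_sub, sub_mul, hpJ, mul_one, one_mul]
    apply ringInverse_eq_of_mul_eq_one
    · simp only [mul_add, add_mul, mul_assoc, mul_smul_comm, smul_mul_assoc,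
        mul_mul_of_mul_eq hpS, mul_mul_of_mul_eq hpp, mul_mul_of_mul_eq hq,
        mul_mul_of_mul_eq hq', hSr, hqq, hSJ, zero_mul, smul_zero]
      simp [hpr]
    · simp only [mul_add, add_mul, mul_assoc, mul_smul_comm, smul_mul_assoc,
        mul_mul_of_mul_eq hpJ, mul_mul_of_mul_eq hpp, mul_mul_of_mul_eq hq,
        mul_mul_of_mul_eq hq', hJr, hqq, hJS, zero_mul, smul_zero]
      simp [hpr]
  -- Here `a⋆ a = (1 - p)(s² - 1) = (1 - p)(s - 1)(s + 1)` and `i j` inverts `s (s + 1)`, leaving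
  -- `(1 - p)(1 - i)`.
  have e4 : star a * (a * (i * j)) = 1 - i - p + p * i := by
    have h1 : star a * a = (1 - p) * ((s - 1) * (s + 1)) := by
      have h : (s - 1) * (s + 1) = a * star a + star a * a := by
        rw [← add_star_mul_self hpa hap]
        linear_combination (norm := noncomm_ring) hss
      rw [h, sub_mul, mul_add p, mul_mul_of_mul_eq hpa, mul_mul_of_mul_eq hpa']
      simp
    rw [← mul_assoc, h1, mul_assoc, mul_assoc, hij, sub_mul s, hsi]
    noncomm_ring
  rw [e2, e1, e3]
  -- The `2⁻¹` corner disappears because `(1 - p) a = 0`.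
  have e5 : star a * (p * (i * j) + (2⁻¹ : ℂ) • (1 - p)) * a = star a * (a * (i * j)) := by
    simp only [mul_add, add_mul, sub_mul, mul_assoc, smul_mul_assoc, hpa, haj, sub_self,
      mul_mul_of_mul_eq hai, mul_mul_of_mul_eq hpa, one_mul, smul_zero, mul_zero, add_zero]
  rw [e5, e4]
  simp only [mul_add, add_mul, mul_sub, sub_mul, mul_one, one_mul, mul_assoc, hpi, hps, hsi,
    mul_mul_of_mul_eq hps, hpp, mul_mul_of_mul_eq hpp, hpa, hap, hpa', hap',
    mul_mul_of_mul_eq hpa, mul_mul_of_mul_eq hap, mul_mul_of_mul_eq hpa', mul_mul_of_mul_eq hap',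
    hai, zero_mul, two_mul]
  abel

theorem norm_matched_block_sub [Nontrivial M] (hp : IsStarProjection p) (hpa : p * a = a)
    (hap : a * p = 0) (h0 : 1 ≤ ‖p + a‖) :
    ‖(1 / 2 : ℂ) • (p * ((cfc Real.sqrt (a * star a + 1) + 1) *
        Ring.inverse (cfc Real.sqrt (a * star a + 1))) * p
      + p * (Ring.inverse (cfc Real.sqrt (a * star a + 1)) * a) * (1 - p)
      + (1 - p) * (star a * Ring.inverse (cfc Real.sqrt (a * star a + 1))) * p
      + (1 - p) * (star a * Ring.inverse (cfc Real.sqrt (a * star a + 1) *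
          (cfc Real.sqrt (a * star a + 1) + 1)) * a) * (1 - p)) - (p + a)‖ =
    1 / 2 * (‖p + a‖ - 1 + √(‖p + a‖ ^ 2 - 1)) := by
  have h := matched_block_formula hp hpa hap h0
  rw [sub_eq_iff_eq_add] at h
  rw [h, smul_add]
  have h2 : (1 / 2 : ℂ) • (2 * (p + a)) = p + a := by
    rw [two_mul, ← two_smul ℂ, smul_smul]; simp
  rw [h2, add_sub_cancel_right, norm_smul, le_antisymm (norm_sub_le_of_offDiagonal hp hpa hap h0)
    (le_norm_sub_of_offDiagonal hp hpa hap h0)]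
  norm_num

end Main

/-! ### Return to the Hilbert module -/

theorem mainTheorem4 {A E : Type*} [NonUnitalCStarAlgebra A] [PartialOrder A] [StarOrderedRing A]
    [NormedAddCommGroup E] [NormedSpace ℂ E] [SMul A E] [CStarModule A E] [CompleteSpace E]
    (Q : Adjointable A E) (hQ : IsIdempotentElem Q) (hQ0 : Q ≠ 0) :
    ‖matchedProjection Q hQ - Q‖ = (1 / 2) * (‖Q‖ - 1 + √(‖Q‖ ^ 2 - 1)) := by
  have h1 := one_le_norm_of_isIdempotentElem hQ hQ0
  by_cases hs : IsStarProjection Q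
  -- A nonzero projection has norm 1, and both sides vanish.
  · have h2 : ‖Q‖ = 1 := le_antisymm hs.norm_le h1
    simp [matchedProjection, hs, h2]
  · let _ := CStarAlgebra.spectralOrder (Adjointable A E)
    have := CStarAlgebra.spectralOrderedRing (Adjointable A E)
    have : Nontrivial (Adjointable A E) := ⟨⟨Q, 0, hQ0⟩⟩
    obtain ⟨hp, hr⟩ := (Adjointable.exists_rangeProjection hQ).choose_spec
    change IsStarProjection (rangeProjection Q hQ) at hp
    change Set.range (rangeProjection Q hQ).toCLM = _ at hr
    -- Idempotents with the same range fix each other from the left; this gives `p a = a` and `a p =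
    -- 0` for `a = Q - p`.
    have hpQ : rangeProjection Q hQ * Q = Q :=
      Adjointable.mul_eq_of_range_subset hp.isIdempotentElem hr.ge
    have hQp : Q * rangeProjection Q hQ = rangeProjection Q hQ :=
      Adjointable.mul_eq_of_range_subset hQ hr.le
    have ha : offDiagonalBlock Q hQ = Q - rangeProjection Q hQ := by
      rw [offDiagonalBlock, mul_sub, mul_one, sub_mul, hQp, hp.isIdempotentElem.eq, sub_self,
        sub_zero]
    have hpa : rangeProjection Q hQ * offDiagonalBlock Q hQ = offDiagonalBlock Q hQ := by
      rw [ha, mul_sub, hpQ, hp.isIdempotentElem.eq]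
    have hap : offDiagonalBlock Q hQ * rangeProjection Q hQ = 0 := by
      rw [ha, sub_mul, hQp, hp.isIdempotentElem.eq, sub_self]
    have hsum : rangeProjection Q hQ + offDiagonalBlock Q hQ = Q := by rw [ha]; abel
    have h := norm_matched_block_sub hp hpa hap (by rwa [hsum])
    rw [hsum] at h
    simpa only [matchedProjection, hs, if_false, sqrtBlock] using h
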